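/- Let $(\Omega,\mathfrak F,\mathbf P)$ be a probability space and let $L^\infty_d$ be the space of essentially bounded $\mathbb R^d$-valued random vectors (up to a.s. equality). For a cone $K\subseteq\mathbb R^d$ write $y\le_K x$ if $x-y\in K$. Let $\mathbb C_K$ be $\mathbb R^d$, extended by a top element $\top$ and a bottom element $\bot$, with the usual addition ($\top$ being absorbing), multiplication by positive scalars, and the reversed order $a\preceq b\iff b\le_K a$ on $\mathbb R^d$. A *$K$-coherent risk measure* is a map $\varrho:L^\infty_d\to\mathbb C_K$ such that for all $X,Y\in L^\infty_d$, $y\in\mathbb R^d$, $t>0$: $\varrho(X)=-x$ if $X=x$ a.s.; $\varrho(X+y)=\varrho(X)-y$; $\varrho(Y)\preceq\varrho(X)$ whenever $Y\le_K X$ a.s.; $\varrho(tX)=t\varrho(X)$; and $\varrho(X)+\varrho(Y)\preceq\varrho(X+Y)$. A *scalar coherent risk measure* is the same notion for real random variables, $d=1$ and $K=[0,\infty)$. Let $\mathrm{ba}(\mathbf P)$ be the set of bounded finitely additive real measures on $\mathfrak F$ that vanish on $\mathbf P$-null sets. For $m\in \mathrm{ba}(\mathbf P)$ and an essentially bounded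 random variable $Z$ let $\mathbf E_m Z=\int Z\,dm$ (the limit of the integrals of simple functions approximating $Z$ in the essential supremum norm). For $\mu=(\mu_1,\dots,\mu_d)\in \mathrm{ba}(\mathbf P)^d$ put $\mathbf E_\mu(X)=\sum_i\mathbf E_{\mu_i}X_i$ and $\langle\mu,y\rangle=\sum_i\mu_i(\Omega)y_i$. Given $\varrho$, let $\mathcal A=\{X:0\preceq\varrho(X)\}$, $\mathcal A^*=\{\mu:\mathbf E_\mu(X)\ge0\text{ for all }X\in\mathcal A\}$ and $Y_X(\mu)=\{y\in\mathbb R^d:\langle\mu,y\rangle\ge-\mathbf E_\mu(X)\}$. **(I)** Let $\varrho$ be an $\mathbb R^d_+$-coherent risk measure. Then: 1. every $\mu\in\mathcal A^*$ has non-negative coordinates, and for every $X\in L^\infty_d$ $$\varrho(X)=\bigvee\bigcap_{\mu\in\mathcal A^*}Y_X(\mu),$$ where $\bigvee$ is the supremum in $\mathbb C_{\mathbb R^d_+}$; 2. for each $i$ let $\mathcal A_i^*$ be the set of $m\in \mathrm{ba}(\mathbf P)$ with $m(\Omega)=1$ and $(0,\dots,0,m,0,\dots,0)\in\mathcal A^*$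 ($m$ in place $i$). Then $\mathcal A_i^*\neq\emptyset$, the infimum $\inf_{m\in\mathcal A_i^*}\mathbf E_mZ$ is finite for every essentially bounded random variable $Z$, the map $\rho_i(Z)=-\inf_{m\in\mathcal A_i^*}\mathbf E_mZ$ is a scalar coherent risk measure, and for every $X\in L_d^\infty$ $$\varrho(X)=\Big(-\inf_{\mu_1\in\mathcal A_1^*}\mathbf E_{\mu_1}X_1,\dots,-\inf_{\mu_d\in\mathcal A_d^*}\mathbf E_{\mu_d}X_d\Big)=(\rho_1(X_1),\dots,\rho_d(X_d)).$$ **(II)** Let $A=(a_{ij})$ be a non-singular real $d\times d$ matrix and $K=A^{-1}\mathbb R^d_+=\{u:Au\in\mathbb R^d_+\}$. (Matrices act on $\mathbb C_K$ by fixing $\top$ and $\bot$.) 1. If $\varrho$ is an $\mathbb R^d_+$-coherent risk measure, then $X\mapsto A^{-1}\varrho(AX)$ is a $K$-coherent risk measure. 2. If $\varrho$ is a $K$-coherent risk measure, then $X\mapsto A\varrho(A^{-1}X)$ is an $\mathbb R^d_+$-coherent risk measure; the values $\mu(B)$, $B\in\mathfrak F$, of every $\mu\in\mathcal A^*$ belong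 to the positive dual cone of $K$; and $\varrho(X)=\bigvee\bigcap_{\mu\in\mathcal A^*}Y_X(\mu)$ for every $X\in L^\infty_d$, the supremum being taken in $\mathbb C_K$. Moreover, for each $i$ let $\mathcal A^*_{A,i}$ be the set of $m\in \mathrm{ba}(\mathbf P)$ with $m(\Omega)=1$ and $(a_{i1}m,\dots,a_{id}m)\in\mathcal A^*$. Then $\mathcal A^*_{A,i}\ne\emptyset$, the infimum $\inf_{m\in\mathcal A^*_{A,i}}\mathbf E_mZ$ is finite for every essentially bounded $Z$, the map $\rho_{A,i}(Z)=-\inf_{m\in\mathcal A^*_{A,i}}\mathbf E_mZ$ is a scalar coherent risk measure, and for every $X\in L_d^\infty$ $$A\varrho(X)=\big(\rho_{A,1}((AX)_1),\dots,\rho_{A,d}((AX)_d)\big).$$ -/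

import Mathlib

open MeasureTheory Filter Topology Set
open scoped ENNReal

namespace VectorRisk

/-! ### The cone of risk values -/

/-- The vector space `E`, extended by a top and a bottom element and equipped with the *reversed*
`K`-order.  It is the space of values of the risk measures. -/
inductive RiskSpace {E : Type*} (K : Set E) where
  | top : RiskSpace K
  | bot : RiskSpace K
  | fin : E → RiskSpace K

namespace RiskSpace

variable {E F : Type*} {K : Set E} {L : Set F}

/-- The usual addition; the top element is absorbing. -/
instance [Add E] : Add (RiskSpace K) where
  add
    | top, _ => top
    | _, top => top
    | bot, _ => bot
    | _, bot => bot
    | fin x, fin y => fin (x + y)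

/-- The usual multiplication by scalars, which is only used for positive scalars. -/
instance [SMul ℝ E] : SMul ℝ (RiskSpace K) where
  smul t
    | top => top
    | bot => bot
    | fin x => fin (t • x)

/-- The neutral element. -/
instance [Zero E] : Zero (RiskSpace K) := ⟨fin 0⟩

/-- The reversed order: `fin x ≤ fin y` if and only if `y ≤_K x`, that is `x - y ∈ K`. -/
instance [Sub E] : LE (RiskSpace K) where
  le
    | _, top => True
    | bot, _ => True
    | fin x, fin y => x - y ∈ K
    | _, _ => False

/-- The extension of a map `E → F` that fixes the top and the bottom element. -/
def map (g : E → F) : RiskSpace K → RiskSpace L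
  | top => top
  | bot => bot
  | fin x => fin (g x)

end RiskSpace

/-! ### Risk measures -/

section RiskMeasures

variable {Ω : Type*} [MeasurableSpace Ω] (P : Measure Ω) [IsProbabilityMeasure P]

/-- `ϱ`, defined on the essentially bounded random elements of `E`, is a risk measure associated
with `f : E → C`, where `E` carries the order `x ≤_K y ↔ y - x ∈ K`. -/
structure IsRiskMeasure {E C : Type*} [NormedAddCommGroup E] [NormedSpace ℝ E] [Add C] [LE C]
    (K : Set E) (f : E → C) (ϱ : Lp E ∞ P → C) : Prop where
  deterministic : ∀ (X : Lp E ∞ P) (x : E), (∀ᵐ ω ∂P, X ω = x) → ϱ X = f x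
  translation : ∀ (y : E) (X : Lp E ∞ P), f y + ϱ X = ϱ (X + Lp.const ∞ P y)
  monotone : ∀ X Y : Lp E ∞ P, (∀ᵐ ω ∂P, X ω - Y ω ∈ K) → ϱ Y ≤ ϱ X

/-- Coherent risk measures: homogeneous risk measures that are superadditive in the order of `C`. -/
structure IsCoherentRiskMeasure {E C : Type*} [NormedAddCommGroup E] [NormedSpace ℝ E]
    [Add C] [LE C] [SMul ℝ C] (K : Set E) (f : E → C) (ϱ : Lp E ∞ P → C) : Prop
    extends IsRiskMeasure P K f ϱ where
  homogeneous : ∀ (t : ℝ) (X : Lp E ∞ P), 0 < t → ϱ (t • X) = t • ϱ X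
  superadditive : ∀ X Y : Lp E ∞ P, ϱ X + ϱ Y ≤ ϱ (X + Y)

/-- `ϱ` is a coherent risk measure on the essentially bounded random elements of `E` with values
in (extended) `E` with the reversed `K`-order, associated with `f(x) = -x`. -/
def IsCoherentVectorRisk {E : Type*} [NormedAddCommGroup E] [NormedSpace ℝ E] (K : Set E)
    (ϱ : Lp E ∞ P → RiskSpace K) : Prop :=
  IsCoherentRiskMeasure P K (fun x => RiskSpace.fin (-x)) ϱ

/-- The acceptance set `{X : e ⪯ ϱ(X)}`. -/
def acceptanceSet {E : Type*} [NormedAddCommGroup E] {K : Set E}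
    (ϱ : Lp E ∞ P → RiskSpace K) : Set (Lp E ∞ P) :=
  {X | 0 ≤ ϱ X}

end RiskMeasures

/-! ### Bounded finitely additive measures and their integrals -/

/-- Bounded finitely additive real measures on the measurable sets that vanish on `P`-null sets. -/
structure Charge {Ω : Type*} [MeasurableSpace Ω] (P : Measure Ω) extends
    AddContent ℝ {B : Set Ω | MeasurableSet B} where
  bounded : ∃ c : ℝ, ∀ B, MeasurableSet B → |toFun B| ≤ c
  null : ∀ B, MeasurableSet B → P B = 0 → toFun B = 0

namespace Charge

variable {Ω : Type*} [MeasurableSpace Ω] {P : Measure Ω}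

instance : CoeFun (Charge P) (fun _ => Set Ω → ℝ) := ⟨fun m => m.toAddContent⟩

instance : Zero (Charge P) where
  zero :=
    { toFun := fun _ => 0
      empty' := rfl
      sUnion' := by simp
      bounded := ⟨0, by simp⟩
      null := by simp }

instance : SMul ℝ (Charge P) where
  smul t m :=
    { toFun := fun B => t * m B
      empty' := by simp
      sUnion' := fun I h₁ h₂ h₃ => by
        rw [addContent_sUnion h₁ h₂ h₃, Finset.mul_sum]
      bounded := by
        obtain ⟨c, hc⟩ := m.bounded
        refine ⟨|t| * c, fun B hB => ?_⟩
        rw [abs_mul]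
        exact mul_le_mul_of_nonneg_left (hc B hB) (abs_nonneg t)
      null := fun B hB h => by
        have : m B = 0 := m.null B hB h
        simp [this] }

/-- The integral of a simple function. -/
noncomputable def simpleIntegral (m : Charge P) (s : SimpleFunc Ω ℝ) : ℝ :=
  ∑ x ∈ s.range, x * m (s ⁻¹' {x})

/-- The filter of simple functions that approximate `X` uniformly up to a null set. -/
noncomputable def approx (P : Measure Ω) (X : Ω → ℝ) : Filter (SimpleFunc Ω ℝ) :=
  comap (fun s : SimpleFunc Ω ℝ => eLpNorm (X - ⇑s) ∞ P) (𝓝 0)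

/-- The expectation `E_m(X)` of an essentially bounded random variable with respect to `m`: the
limit of the integrals of simple functions that approximate `X` in the essential supremum norm. -/
noncomputable def expect (m : Charge P) (X : Lp ℝ ∞ P) : ℝ :=
  limUnder (approx P X) m.simpleIntegral

/-! The limit in the definition of `expect` exists. -/

lemma apply_union (m : Charge P) {B D : Set Ω} (hB : MeasurableSet B) (hD : MeasurableSet D)
    (h : Disjoint B D) : m (B ∪ D) = m B + m D :=
  addContent_union' (C := {B : Set Ω | MeasurableSet B}) hB hD (hB.union hD) h

lemma simpleIntegral_eq (m : Charge P) (s : SimpleFunc Ω ℝ) : m.simpleIntegral s =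
    s.setToSimpleFunc (fun B => m B • ContinuousLinearMap.id ℝ ℝ) := by
  simp [simpleIntegral, SimpleFunc.setToSimpleFunc, mul_comm]

lemma simpleIntegral_sub (m : Charge P) (s t : SimpleFunc Ω ℝ) :
    m.simpleIntegral (s - t) = m.simpleIntegral s - m.simpleIntegral t := by
  have hi : ∀ r : SimpleFunc Ω ℝ, Integrable r (0 : Measure Ω) := fun r =>
    integrable_zero_measure
  rw [simpleIntegral_eq, simpleIntegral_eq, simpleIntegral_eq,
    SimpleFunc.setToSimpleFunc_sub (μ := (0 : Measure Ω)) _ _ (hi s) (hi t)]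
  intro B D hB hD _ _ h
  simp [m.apply_union hB hD h, add_smul]

lemma apply_biUnion (m : Charge P) (s : SimpleFunc Ω ℝ) (T : Finset ℝ) :
    ∑ x ∈ T, m (s ⁻¹' {x}) = m (s ⁻¹' (T : Set ℝ)) := by
  classical
  induction T using Finset.induction_on with
  | empty => simp
  | insert a T ha ih =>
    rw [Finset.sum_insert ha, ih, Finset.coe_insert, Set.insert_eq, Set.preimage_union,
      m.apply_union (s.measurableSet_preimage _) (s.measurableSet_preimage _)]
    refine Disjoint.preimage _ ?_
    simpa using ha

lemma abs_simpleIntegral_le (m : Charge P) {c : ℝ}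
    (hc : ∀ B, MeasurableSet B → |m B| ≤ c) (s : SimpleFunc Ω ℝ) {ε : ℝ}
    (hε : 0 ≤ ε) (hs : ∀ᵐ ω ∂P, |s ω| ≤ ε) : |m.simpleIntegral s| ≤ ε * (c + c) := by
  classical
  have key : ∀ x ∈ s.range, |x * m (s ⁻¹' {x})| ≤ ε * |m (s ⁻¹' {x})| := by
    intro x _
    rw [abs_mul]
    by_cases hx : |x| ≤ ε
    · exact mul_le_mul_of_nonneg_right hx (abs_nonneg _)
    · have h0 : m (s ⁻¹' {x}) = 0 := by
        refine m.null _ (s.measurableSet_fiber x) (measure_mono_null ?_ hs)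
        intro ω hω
        have : s ω = x := hω
        simpa [this] using hx
      simp [h0]
  refine (Finset.abs_sum_le_sum_abs _ _).trans ((Finset.sum_le_sum key).trans ?_)
  rw [← Finset.mul_sum]
  refine mul_le_mul_of_nonneg_left ?_ hε
  rw [← Finset.sum_filter_add_sum_filter_not s.range (fun x => 0 ≤ m (s ⁻¹' {x}))]
  refine add_le_add ?_ ?_
  · rw [Finset.sum_congr rfl (g := fun x => m (s ⁻¹' {x}))
      (fun x hx => abs_of_nonneg (Finset.mem_filter.1 hx).2), apply_biUnion]
    exact (le_abs_self _).trans (hc _ (s.measurableSet_preimage _))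
  · rw [Finset.sum_congr rfl (g := fun x => -m (s ⁻¹' {x}))
      (fun x hx => abs_of_neg (not_le.1 (Finset.mem_filter.1 hx).2)), Finset.sum_neg_distrib,
      apply_biUnion]
    exact (neg_le_abs _).trans (hc _ (s.measurableSet_preimage _))

lemma exists_simple (X : Lp ℝ ∞ P) {ε : ℝ} (hε : 0 < ε) :
    ∃ s : SimpleFunc Ω ℝ, ∀ᵐ ω ∂P, |X ω - s ω| ≤ ε := by
  have hX : MemLp X ∞ P := Lp.memLp X
  have hm := Lp.stronglyMeasurable X
  obtain ⟨c, hc⟩ : ∃ c : ℝ, ∀ᵐ ω ∂P, |X ω| ≤ c := by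
    refine ⟨(eLpNormEssSup X P).toReal, ?_⟩
    have h := enorm_ae_le_eLpNormEssSup X P
    have hfin : eLpNormEssSup X P ≠ ∞ := by
      have := hX.2
      rw [eLpNorm_exponent_top] at this
      exact this.ne
    filter_upwards [h] with ω hω
    have := ENNReal.toReal_mono hfin hω
    simpa using this
  let g : Ω → ℝ := fun ω => ε * ⌊max (-c) (min c (X ω)) / ε⌋
  have hg : Measurable g := by
    have := hm.measurable
    fun_prop
  have hfin : (range g).Finite := by
    refine ((Set.finite_Icc ⌊min (-c) c / ε⌋ ⌊max (-c) c / ε⌋).image (fun k : ℤ => ε * (k : ℝ))).subset ?_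
    rintro _ ⟨ω, rfl⟩
    refine ⟨_, ⟨Int.floor_mono ?_, Int.floor_mono ?_⟩, rfl⟩
    · gcongr
      exact (min_le_left _ _).trans (le_max_left _ _)
    · gcongr
      exact min_le_left _ _
  refine ⟨⟨g, fun x => hg (measurableSet_singleton x), hfin⟩, ?_⟩
  filter_upwards [hc] with ω hω
  have h1 := abs_le.1 hω
  have h2 : max (-c) (min c (X ω)) = X ω := by
    rw [min_eq_right h1.2, max_eq_right h1.1]
  change |X ω - ε * ⌊max (-c) (min c (X ω)) / ε⌋| ≤ ε
  rw [h2]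
  have h3 := Int.floor_le (X ω / ε)
  have h4 := Int.lt_floor_add_one (X ω / ε)
  rw [le_div_iff₀ hε] at h3
  rw [div_lt_iff₀ hε] at h4
  rw [abs_le]
  constructor <;> nlinarith

lemma hasBasis_approx (X : Ω → ℝ) : (approx P X).HasBasis (fun ε : ℝ => 0 < ε)
    (fun ε => {s : SimpleFunc Ω ℝ | ∀ᵐ ω ∂P, |X ω - s ω| ≤ ε}) := by
  refine ⟨fun U => ?_⟩
  have hb := (ENNReal.nhds_zero_basis_Iic).comap
    (fun s : SimpleFunc Ω ℝ => eLpNorm (X - ⇑s) ∞ P)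
  have hiff : ∀ (ε : ℝ) (_ : 0 ≤ ε) (s : SimpleFunc Ω ℝ),
      eLpNorm (X - ⇑s) ∞ P ≤ ENNReal.ofReal ε ↔ ∀ᵐ ω ∂P, |X ω - s ω| ≤ ε := by
    intro ε hε s
    rw [eLpNorm_exponent_top]
    constructor
    · intro h
      filter_upwards [enorm_ae_le_eLpNormEssSup (X - ⇑s) P] with ω hω
      have := hω.trans h
      rw [← ofReal_norm, ENNReal.ofReal_le_ofReal_iff hε] at this
      simpa using this
    · intro h
      refine eLpNormEssSup_le_of_ae_bound ?_
      simpa using h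
  constructor
  · intro hU
    obtain ⟨δ, hδ, hsub⟩ := hb.mem_iff.1 hU
    obtain ⟨ε, hε0, hε⟩ : ∃ ε : ℝ, 0 < ε ∧ ENNReal.ofReal ε ≤ δ := by
      refine ⟨(min δ 1).toReal, ENNReal.toReal_pos (by simp [hδ.ne']) (by simp), ?_⟩
      rw [ENNReal.ofReal_toReal (by simp)]
      exact min_le_left _ _
    exact ⟨ε, hε0, fun s hs => hsub (((hiff ε hε0.le s).2 hs).trans hε)⟩
  · rintro ⟨ε, hε, hsub⟩
    exact hb.mem_iff.2 ⟨ENNReal.ofReal ε, by simpa using hε,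
      fun s hs => hsub ((hiff ε hε.le s).1 hs)⟩

instance (X : Lp ℝ ∞ P) : (approx P X).NeBot :=
  (hasBasis_approx (P := P) X).neBot_iff.2 fun hε => exists_simple X hε

/-- The limit that defines `expect` exists. -/
lemma tendsto_expect (m : Charge P) (X : Lp ℝ ∞ P) :
    Tendsto m.simpleIntegral (approx P X) (𝓝 (m.expect X)) := by
  have hcauchy : Cauchy (map m.simpleIntegral (approx P X)) := by
    obtain ⟨c, hc⟩ := m.bounded
    have hc0 : 0 ≤ c := (abs_nonneg _).trans (hc ∅ MeasurableSet.empty)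
    refine Metric.cauchy_iff.2 ⟨inferInstance, fun ε hε => ?_⟩
    have hδ : 0 < ε / (4 * c + 1) / 2 := by positivity
    refine ⟨_, image_mem_map ((hasBasis_approx (P := P) X).mem_of_mem hδ), ?_⟩
    rintro _ ⟨s, hs, rfl⟩ _ ⟨t, ht, rfl⟩
    rw [Real.dist_eq, ← simpleIntegral_sub]
    refine (m.abs_simpleIntegral_le hc (s - t) (ε := ε / (4 * c + 1)) (by positivity) ?_).trans_lt ?_
    · filter_upwards [hs, ht] with ω h1 h2
      rw [SimpleFunc.sub_apply]
      rw [abs_le] at *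
      constructor <;> linarith [h1.1, h1.2, h2.1, h2.2]
    · rw [div_mul_eq_mul_div, div_lt_iff₀ (by positivity)]
      nlinarith
  obtain ⟨l, hl⟩ := CompleteSpace.complete hcauchy
  exact tendsto_nhds_limUnder ⟨l, hl⟩

end Charge

/-! ### Duality -/

section Duality

variable {Ω : Type*} [MeasurableSpace Ω] {P : Measure Ω} {d : ℕ}

/-- The coordinate `X_i` of a random vector. -/
noncomputable def coord (i : Fin d) (X : Lp (Fin d → ℝ) ∞ P) : Lp ℝ ∞ P :=
  (ContinuousLinearMap.proj (R := ℝ) (φ := fun _ : Fin d => ℝ) i).compLp X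

/-- The random vector `A X`. -/
noncomputable def matMul (A : Matrix (Fin d) (Fin d) ℝ) (X : Lp (Fin d → ℝ) ∞ P) :
    Lp (Fin d → ℝ) ∞ P :=
  (LinearMap.toContinuousLinearMap A.mulVecLin).compLp X

/-- `E_μ(X) = ∑ i, ∫ X_i dμ_i` for a vector measure `μ`. -/
noncomputable def vecExpect (μ : Fin d → Charge P) (X : Lp (Fin d → ℝ) ∞ P) : ℝ :=
  ∑ i, (μ i).expect (coord i X)

/-- `⟨μ, y⟩ = ∑ i, μ_i(Ω) y_i`. -/
noncomputable def totalPairing (μ : Fin d → Charge P) (y : Fin d → ℝ) : ℝ :=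
  ∑ i, μ i univ * y i

/-- The polar `𝒜*` of a set `𝒜` of random vectors. -/
def polar (𝒜 : Set (Lp (Fin d → ℝ) ∞ P)) : Set (Fin d → Charge P) :=
  {μ | ∀ X ∈ 𝒜, 0 ≤ vecExpect μ X}

/-- The half-space `{y : ⟨μ, y⟩ ≥ -E_μ(X)}`. -/
def dualHalfspace (μ : Fin d → Charge P) (X : Lp (Fin d → ℝ) ∞ P) : Set (Fin d → ℝ) :=
  {y | -vecExpect μ X ≤ totalPairing μ y}

/-- The normalised measures `m` such that `(0, …, 0, m, 0, …, 0)`, with `m` in place `i`,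
belongs to `𝒜*`. -/
def marginalPolar (𝒜 : Set (Lp (Fin d → ℝ) ∞ P)) (i : Fin d) : Set (Charge P) :=
  {m | m univ = 1 ∧ Pi.single i m ∈ polar 𝒜}

/-- The normalised measures `m` such that the vector measure `(a_{i1} m, …, a_{id} m)`, for which
the expectation of `X` is `E_m((A X)_i)`, belongs to `𝒜*`. -/
def rowPolar (A : Matrix (Fin d) (Fin d) ℝ) (𝒜 : Set (Lp (Fin d → ℝ) ∞ P)) (i : Fin d) :
    Set (Charge P) :=
  {m | m univ = 1 ∧ (fun j => A i j • m) ∈ polar 𝒜}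

/-- `-inf_{m ∈ M} E_m(Z)`. -/
noncomputable def worstCase (M : Set (Charge P)) (Z : Lp ℝ ∞ P) : ℝ :=
  -sInf ((fun m : Charge P => m.expect Z) '' M)

/-- `K = A⁻¹ ℝ^d_+`. -/
def matrixCone (A : Matrix (Fin d) (Fin d) ℝ) : Set (Fin d → ℝ) :=
  {u | ∀ i, 0 ≤ A.mulVec u i}

/-- `K = ℝ^d_+`. -/
def orthant (d : ℕ) : Set (Fin d → ℝ) :=
  {u | ∀ i, 0 ≤ u i}

end Duality

end VectorRisk

open VectorRisk

/-!
The two cones are treated together: let `K = {u : A u ≥ 0}` with `A` invertible; the orthant is the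
case `A = 1`.  A `K`-coherent risk measure `ϱ` is finite, because `K` has interior points.  The
`i`-th coordinate of `A ϱ(X)` is decreasing in the random vector `A X`, and it does not change when
a constant with vanishing `i`-th coordinate is added to `A X`.  Such constants make the other
coordinates of `A X` as large as desired, so that `(A ϱ(X))_i` depends only on `(A X)_i`
(`mulVec_apply_le_of_ae_le`, `mulVec_apply_eq_rowRisk`).  Hence
`A ϱ(X) = (ρ_1((A X)_1), …, ρ_d((A X)_d))` for scalar coherent risk measures `ρ_i` (`rowRisk`).

For a scalar coherent risk measure `ρ`, the map `Y ↦ ρ(-Y)` is a sublinear functional.  By the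
Hahn–Banach theorem it dominates a linear functional that touches it at `-Z`.  Such a functional
is positive, normalised and bounded in the essential supremum norm, so it is integration with
respect to a charge (`Charge.exists_expect_eq`).  This gives `ρ(Z) = -min E_m(Z)`
over the normalised charges that are non-negative on the acceptance set
(`exists_mem_scalarPolar_expect_eq`, `worstCase_scalarPolar`).  By the decoupling of the
coordinates these are the charges `m` for which `(a_{i1} m, …, a_{id} m)` belongs to `𝒜*`
(`rowPolar_acceptanceSet`).  Their half-spaces already cut out the set of all `y` with
`A y ≥ A ϱ(X)`, and `ϱ(X)` belongs to every dual half-space because `X + ϱ(X)` is acceptable;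
this is the representation as a supremum (`isLUB_dualHalfspace`).
-/

namespace VectorRisk

/-! ### Integration with respect to a charge -/

namespace Charge

variable {Ω : Type*} [MeasurableSpace Ω] {P : Measure Ω}

/-- To compute `E_m(X)` it suffices to bound the error of the integrals of approximating simple
functions linearly in the essential distance. -/
lemma expect_eq_of_forall_approx (m : Charge P) (X : Lp ℝ ∞ P) (v c : ℝ)
    (h : ∀ ε > 0, ∀ s : SimpleFunc Ω ℝ, (∀ᵐ ω ∂P, |X ω - s ω| ≤ ε) →
      |m.simpleIntegral s - v| ≤ c * ε) : m.expect X = v := by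
  refine tendsto_nhds_unique (m.tendsto_expect X) (Metric.tendsto_nhds.2 fun δ hδ => ?_)
  have hpos : 0 < δ / (2 * (|c| + 1)) := by positivity
  filter_upwards [(hasBasis_approx (P := P) X).mem_of_mem hpos] with s hs
  rw [Real.dist_eq]
  refine (h _ hpos s hs).trans_lt ?_
  rw [← mul_div_assoc, div_lt_iff₀ (by positivity)]
  nlinarith [le_abs_self c, abs_nonneg c]

lemma exists_abs_simpleIntegral_sub_expect_le (m : Charge P) : ∃ c : ℝ, 0 ≤ c ∧
    ∀ (X : Lp ℝ ∞ P) (ε : ℝ), 0 < ε → ∀ s : SimpleFunc Ω ℝ, (∀ᵐ ω ∂P, |X ω - s ω| ≤ ε) →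
      |m.simpleIntegral s - m.expect X| ≤ c * ε := by
  obtain ⟨c, hc⟩ := m.bounded
  have hc0 : 0 ≤ c := (abs_nonneg _).trans (hc ∅ MeasurableSet.empty)
  refine ⟨4 * c, by positivity, fun X ε hε s hs => ?_⟩
  have hlim : Tendsto (fun t => |m.simpleIntegral s - m.simpleIntegral t|) (approx P X)
      (𝓝 |m.simpleIntegral s - m.expect X|) :=
    (tendsto_const_nhds.sub (m.tendsto_expect X)).abs
  refine le_of_tendsto hlim ?_
  filter_upwards [(hasBasis_approx (P := P) X).mem_of_mem hε] with t ht
  rw [← simpleIntegral_sub]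
  refine (m.abs_simpleIntegral_le hc (s - t) (ε := 2 * ε) (by positivity) ?_).trans_eq (by ring)
  filter_upwards [hs, ht] with ω h1 h2
  rw [SimpleFunc.sub_apply]
  rw [abs_le] at *
  constructor <;> linarith [h1.1, h1.2, h2.1, h2.2]

lemma simpleIntegral_const_mul (m : Charge P) (a : ℝ) (s : SimpleFunc Ω ℝ) :
    m.simpleIntegral (a • s) = a * m.simpleIntegral s := by
  have hi : Integrable s (0 : Measure Ω) := integrable_zero_measure
  rw [simpleIntegral_eq, simpleIntegral_eq,
    SimpleFunc.setToSimpleFunc_smul_real (μ := (0 : Measure Ω)) _ _ a hi, smul_eq_mul]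
  intro B D hB hD _ _ h
  simp [m.apply_union hB hD h, add_smul]

lemma expect_add (m : Charge P) (X Y : Lp ℝ ∞ P) :
    m.expect (X + Y) = m.expect X + m.expect Y := by
  obtain ⟨c, hc0, hc⟩ := m.exists_abs_simpleIntegral_sub_expect_le
  refine m.expect_eq_of_forall_approx _ _ (4 * c) fun ε hε s hs => ?_
  obtain ⟨t, ht⟩ := exists_simple X hε
  have h1 := hc X ε hε t ht
  have h2 := hc Y (2 * ε) (by positivity) (s - t) (by
    filter_upwards [hs, ht, Lp.coeFn_add X Y] with ω h1 h2 h3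
    rw [h3, Pi.add_apply] at h1
    rw [SimpleFunc.sub_apply]
    rw [abs_le] at *
    constructor <;> linarith [h1.1, h1.2, h2.1, h2.2])
  rw [simpleIntegral_sub] at h2
  have hcε : 0 ≤ c * ε := by positivity
  rw [abs_le] at *
  constructor <;> linarith [h1.1, h1.2, h2.1, h2.2]

lemma expect_smul (m : Charge P) (a : ℝ) (X : Lp ℝ ∞ P) :
    m.expect (a • X) = a * m.expect X := by
  obtain ⟨c, hc0, hc⟩ := m.exists_abs_simpleIntegral_sub_expect_le
  refine m.expect_eq_of_forall_approx _ _ (2 * c * (1 + |a|) + |a| * c) fun ε hε s hs => ?_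
  obtain ⟨t, ht⟩ := exists_simple X hε
  have h1 := hc X ε hε t ht
  have h2 := hc (a • X) ((1 + |a|) * ε) (by positivity) s (by
    filter_upwards [hs] with ω h
    refine h.trans ?_
    nlinarith [abs_nonneg a])
  have h3 := hc (a • X) ((1 + |a|) * ε) (by positivity) (a • t) (by
    filter_upwards [ht, Lp.coeFn_smul a X] with ω h3 h4
    rw [h4, SimpleFunc.smul_apply, Pi.smul_apply, smul_eq_mul, smul_eq_mul, ← mul_sub, abs_mul]
    nlinarith [abs_nonneg a])
  rw [simpleIntegral_const_mul] at h3
  have h4 : |a * m.simpleIntegral t - a * m.expect X| ≤ |a| * (c * ε) := by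
    rw [← mul_sub, abs_mul]
    exact mul_le_mul_of_nonneg_left h1 (abs_nonneg a)
  have h5 : |m.simpleIntegral s - a * m.expect X| ≤
      |m.simpleIntegral s - m.expect (a • X)| + |a * m.simpleIntegral t - m.expect (a • X)| +
      |a * m.simpleIntegral t - a * m.expect X| := by
    grind
  linarith

/-- The integral `X ↦ E_m(X)` as a linear functional. -/
noncomputable def expectₗ (m : Charge P) : Lp ℝ ∞ P →ₗ[ℝ] ℝ where
  toFun := m.expect
  map_add' := m.expect_add
  map_smul' := m.expect_smul

@[simp] lemma expectₗ_apply (m : Charge P) (X : Lp ℝ ∞ P) : m.expectₗ X = m.expect X := rfl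

lemma smul_apply (a : ℝ) (m : Charge P) (B : Set Ω) : (a • m) B = a * m B := rfl

lemma zero_apply (B : Set Ω) : (0 : Charge P) B = 0 := rfl

lemma ext_apply {m n : Charge P} (h : ∀ B, m B = n B) : m = n := by
  obtain ⟨m, _, _⟩ := m
  obtain ⟨n, _, _⟩ := n
  obtain rfl : m = n := AddContent.ext h
  rfl

lemma simpleIntegral_smul (a : ℝ) (m : Charge P) (s : SimpleFunc Ω ℝ) :
    (a • m).simpleIntegral s = a * m.simpleIntegral s := by
  simp only [simpleIntegral, smul_apply, Finset.mul_sum]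
  exact Finset.sum_congr rfl fun x _ => by ring

lemma smul_expect (a : ℝ) (m : Charge P) (X : Lp ℝ ∞ P) :
    (a • m).expect X = a * m.expect X := by
  refine tendsto_nhds_unique ((a • m).tendsto_expect X) ?_
  simp only [funext (simpleIntegral_smul a m)]
  exact (m.tendsto_expect X).const_mul a

lemma expect_indicatorConstLp (m : Charge P) [IsFiniteMeasure P] {B : Set Ω}
    (hB : MeasurableSet B) :
    m.expect (indicatorConstLp ∞ hB (measure_ne_top P B) 1) = m B := by
  classical
  obtain ⟨c, hc0, hc⟩ := m.exists_abs_simpleIntegral_sub_expect_le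
  let s : SimpleFunc Ω ℝ := .piecewise B hB (.const Ω 1) (.const Ω 0)
  have hs : m.simpleIntegral s = m B := by
    rw [simpleIntegral_eq, SimpleFunc.setToSimpleFunc_indicator _ (by simp) hB]
    simp
  have hle : ∀ ε > 0, |m B - m.expect (indicatorConstLp ∞ hB (measure_ne_top P B) 1)| ≤ c * ε := by
    intro ε hε
    rw [← hs]
    refine hc _ ε hε s ?_
    filter_upwards [indicatorConstLp_coeFn (p := ∞) (hs := hB) (hμs := measure_ne_top P B)
      (c := (1 : ℝ))] with ω hω
    rw [hω]
    by_cases h : ω ∈ B <;> simp [s, h, hε.le]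
  refine (sub_eq_zero.1 (abs_nonpos_iff.1 (le_of_forall_pos_le_add fun ε hε => ?_))).symm
  refine (hle (ε / (c + 1)) (by positivity)).trans ?_
  rw [zero_add, ← mul_div_assoc, div_le_iff₀ (by positivity)]
  nlinarith

/-- A linear functional `f` of norm at most one on `L^∞` is the integral with respect to the charge
`B ↦ f(1_B)`.  The bound is stated with almost sure bounds instead of the norm. -/
lemma exists_expect_eq [IsProbabilityMeasure P] (f : Lp ℝ ∞ P →ₗ[ℝ] ℝ)
    (hf : ∀ (Z : Lp ℝ ∞ P) (ε : ℝ), 0 ≤ ε → (∀ᵐ ω ∂P, |Z ω| ≤ ε) → |f Z| ≤ ε) :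
    ∃ m : Charge P, ∀ Z, m.expect Z = f Z := by
  classical
  let ind : ∀ B : Set Ω, MeasurableSet B → Lp ℝ ∞ P := fun B hB =>
    indicatorConstLp ∞ hB (measure_ne_top P B) 1
  have hind : ∀ B (hB : MeasurableSet B), ∀ᵐ ω ∂P, ind B hB ω = B.indicator (fun _ => 1) ω :=
    fun B hB => indicatorConstLp_coeFn
  -- A charge is a function of all sets; on non-measurable sets its value plays no role.
  let g : Set Ω → ℝ := fun B => if hB : MeasurableSet B then f (ind B hB) else 0
  have hg : ∀ B (hB : MeasurableSet B), g B = f (ind B hB) := fun B hB => dif_pos hB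
  have hg0 : ∀ B, MeasurableSet B → P B = 0 → g B = 0 := by
    intro B hB h
    rw [hg B hB, ← abs_nonpos_iff]
    refine hf _ 0 le_rfl ?_
    filter_upwards [hind B hB, measure_eq_zero_iff_ae_notMem.1 h] with ω h1 h2
    simp [h1, h2]
  have hU : ∀ B D (hB : MeasurableSet B) (hD : MeasurableSet D), Disjoint B D →
      g (B ∪ D) = g B + g D := by
    intro B D hB hD h
    rw [hg _ (hB.union hD), hg _ hB, hg _ hD, ← map_add]
    congr 1
    apply Lp.ext
    filter_upwards [hind _ (hB.union hD), hind B hB, hind D hD,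
      Lp.coeFn_add (ind B hB) (ind D hD)] with ω h1 h2 h3 h4
    rw [h1, h4, Pi.add_apply, h2, h3, indicator_union_of_disjoint h]
  have hsum : ∀ I : Finset (Set Ω), (∀ B ∈ I, MeasurableSet B) →
      PairwiseDisjoint (I : Set (Set Ω)) id → g (⋃₀ I) = ∑ u ∈ I, g u := by
    intro I
    induction I using Finset.induction_on with
    | empty =>
      intro _ _
      simpa using hg0 ∅ MeasurableSet.empty measure_empty
    | insert B I hBI ih =>
      intro hm hd
      rw [Finset.sum_insert hBI, Finset.coe_insert, sUnion_insert, hU _ _ (hm B (by simp)), ih]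
      · exact fun D hD => hm D (by simp [hD])
      · exact hd.subset (by simp)
      · exact MeasurableSet.sUnion I.countable_toSet fun D hD => hm D (by simp_all)
      · rw [disjoint_sUnion_right]
        intro D hD
        refine hd (by simp) (by simp_all) ?_
        rintro rfl
        exact hBI hD
  let m : Charge P :=
    { toFun := g
      empty' := hg0 ∅ MeasurableSet.empty measure_empty
      sUnion' := fun I h₁ h₂ _ => hsum I h₁ h₂
      bounded := by
        refine ⟨1, fun B hB => ?_⟩
        rw [hg B hB]
        refine hf _ 1 zero_le_one ?_
        filter_upwards [hind B hB] with ω hω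
        rw [hω]
        by_cases h : ω ∈ B <;> simp [h]
      null := hg0 }
  refine ⟨m, fun Z => m.expect_eq_of_forall_approx Z _ 1 fun ε hε s hs => ?_⟩
  have hm : m.simpleIntegral s = f (∑ x ∈ s.range, x • ind _ (s.measurableSet_fiber x)) := by
    rw [map_sum]
    refine Finset.sum_congr rfl fun x _ => ?_
    rw [map_smul, smul_eq_mul, ← hg]
    rfl
  have hrepr : ∀ᵐ ω ∂P, (∑ x ∈ s.range, x • ind _ (s.measurableSet_fiber x) : Lp ℝ ∞ P) ω
      = s ω := by
    have h1 : ∀ᵐ ω ∂P, ∀ x ∈ s.range, (x • ind _ (s.measurableSet_fiber x) : Lp ℝ ∞ P) ω =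
        x * (s ⁻¹' {x}).indicator (fun _ => 1) ω := by
      rw [Finset.eventually_all]
      intro x _
      filter_upwards [hind _ (s.measurableSet_fiber x),
        Lp.coeFn_smul x (ind _ (s.measurableSet_fiber x))] with ω h1 h2
      rw [h2, Pi.smul_apply, h1, smul_eq_mul]
    filter_upwards [h1, Lp.coeFn_finsetSum s.range
      fun x => x • ind _ (s.measurableSet_fiber x)] with ω h1 h2
    rw [h2, Finset.sum_apply, Finset.sum_congr rfl h1]
    rw [Finset.sum_eq_single (s ω)]
    · simp
    · intro x _ hx
      have : ω ∉ s ⁻¹' {x} := fun h => hx (by simpa using h.symm)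
      simp [this]
    · intro h
      exact absurd (s.mem_range_self ω) h
  rw [hm, ← map_sub, one_mul]
  refine hf _ ε hε.le ?_
  filter_upwards [hs, hrepr, Lp.coeFn_sub
    (∑ x ∈ s.range, x • ind _ (s.measurableSet_fiber x)) Z] with ω h1 h2 h3
  rwa [h3, Pi.sub_apply, h2, abs_sub_comm]

end Charge

/-! ### Finite risk values and essential bounds -/

namespace RiskSpace

variable {E : Type*} {K : Set E}

/-- An element of the extended space between two finite elements is finite. -/
lemma exists_eq_fin [Sub E] {a : RiskSpace K} {x y : E} (hx : fin x ≤ a) (hy : a ≤ fin y) :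
    ∃ z, a = fin z := by
  cases a with
  | top => exact hy.elim
  | bot => exact hx.elim
  | fin z => exact ⟨z, rfl⟩

end RiskSpace

open RiskSpace

section

variable {Ω : Type*} [MeasurableSpace Ω] {P : Measure Ω}

lemma exists_ae_norm_le {E : Type*} [NormedAddCommGroup E] (X : Lp E ∞ P) :
    ∃ c : ℝ, ∀ᵐ ω ∂P, ‖X ω‖ ≤ c := by
  refine ⟨(eLpNormEssSup X P).toReal, ?_⟩
  have hfin : eLpNormEssSup X P ≠ ∞ := by
    have := (Lp.memLp X).2
    rw [eLpNorm_exponent_top] at this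
    exact this.ne
  filter_upwards [enorm_ae_le_eLpNormEssSup X P] with ω hω
  simpa using ENNReal.toReal_mono hfin hω

end

section Scalar

variable {Ω : Type*} [MeasurableSpace Ω] {P : Measure Ω} [IsProbabilityMeasure P]

/-! ### Dual representation of scalar coherent risk measures -/

/-- The normalised charges whose integral is non-negative on the acceptance set
`{Z : ρ(Z) ≤ 0}` of the scalar risk measure `ρ`. -/
def scalarPolar (ρ : Lp ℝ ∞ P → ℝ) : Set (Charge P) :=
  {m | m univ = 1 ∧ ∀ Z, ρ Z ≤ 0 → 0 ≤ m.expect Z}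

lemma Charge.expect_const (m : Charge P) (y : ℝ) : m.expect (Lp.const ∞ P y) = m univ * y := by
  have h : Lp.const ∞ P y = y • Lp.const ∞ P (1 : ℝ) := by
    have := (Lp.constₗ ∞ P ℝ).map_smul y (1 : ℝ)
    simpa using this
  rw [h, expect_smul, ← indicatorConstLp_univ, expect_indicatorConstLp, mul_comm]

variable {ρ : Lp ℝ ∞ P → ℝ}

lemma neg_le_expect_of_mem_scalarPolar
    (h : IsCoherentVectorRisk P (Ici (0 : ℝ)) fun Z => fin (ρ Z)) {m : Charge P}
    (hm : m ∈ scalarPolar ρ) (Z : Lp ℝ ∞ P) : -ρ Z ≤ m.expect Z := by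
  -- `Z + ρ(Z)` is acceptable.
  have h1 : -ρ Z + ρ Z = ρ (Z + Lp.const ∞ P (ρ Z)) := fin.inj (h.translation (ρ Z) Z)
  have h2 := hm.2 (Z + Lp.const ∞ P (ρ Z)) (by linarith)
  rw [Charge.expect_add, Charge.expect_const, hm.1] at h2
  linarith

/-- The infimum in the dual representation is attained: the charge is given by a linear functional
that is dominated by the sublinear functional `Y ↦ ρ(-Y)` and touches it at `-Z`. -/
lemma exists_mem_scalarPolar_expect_eq
    (h : IsCoherentVectorRisk P (Ici (0 : ℝ)) fun Z => fin (ρ Z)) (Z : Lp ℝ ∞ P) :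
    ∃ m ∈ scalarPolar ρ, m.expect Z = -ρ Z := by
  have hhom : ∀ (t : ℝ) Y, 0 < t → ρ (t • Y) = t * ρ Y := fun t Y ht =>
    fin.inj (h.homogeneous t Y ht)
  have hadd : ∀ X Y, ρ (X + Y) ≤ ρ X + ρ Y := fun X Y => by
    have : (0 : ℝ) ≤ ρ X + ρ Y - ρ (X + Y) := h.superadditive X Y
    linarith
  have hmono : ∀ X Y : Lp ℝ ∞ P, (∀ᵐ ω ∂P, Y ω ≤ X ω) → ρ X ≤ ρ Y := fun X Y hXY => by
    have : (0 : ℝ) ≤ ρ Y - ρ X := h.monotone X Y (by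
      filter_upwards [hXY] with ω hω
      exact sub_nonneg.2 hω)
    linarith
  have hconst : ∀ y, ρ (Lp.const ∞ P y) = -y := fun y =>
    fin.inj (h.deterministic _ y (Lp.coeFn_const ..))
  have h0 : ρ 0 = 0 := by
    have := hconst 0
    rwa [map_zero, neg_zero] at this
  -- On the line spanned by `Z` the functional `a Z ↦ -a ρ(Z)` is dominated by `Y ↦ ρ(-Y)`.
  obtain ⟨f, hfZ, hf⟩ : ∃ f : Lp ℝ ∞ P →ₗ[ℝ] ℝ, f Z = -ρ Z ∧ ∀ Y, f Y ≤ ρ (-Y) := by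
    obtain ⟨f, hf1, hf⟩ := exists_extension_of_le_sublinear
      (LinearPMap.mkSpanSingleton' Z (-ρ Z) fun c hc => by
        rcases smul_eq_zero.1 hc with rfl | rfl <;> simp [h0])
      (fun Y => ρ (-Y)) (fun c hc Y => by simp [← smul_neg, hhom c _ hc])
      (fun X Y => by simpa [neg_add, add_comm] using hadd (-X) (-Y))
      (fun x => by
        obtain ⟨x, hx⟩ := x
        obtain ⟨a, rfl⟩ := Submodule.mem_span_singleton.1 hx
        rw [LinearPMap.mkSpanSingleton'_apply]
        rcases lt_trichotomy a 0 with ha | rfl | ha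
        · have := hhom (-a) Z (by linarith)
          rw [neg_smul] at this
          simp [this]
        · simp [h0]
        · have h1 := hadd (a • Z) (-(a • Z))
          rw [add_neg_cancel, h0, hhom a Z ha] at h1
          simp only [RingHom.id_apply, smul_eq_mul]
          linarith)
    refine ⟨f, ?_, hf⟩
    exact (hf1 ⟨Z, Submodule.mem_span_singleton_self Z⟩).trans
      (LinearPMap.mkSpanSingleton'_apply_self ..)
  have hfle : ∀ (Y : Lp ℝ ∞ P) (ε : ℝ), (∀ᵐ ω ∂P, Y ω ≤ ε) → f Y ≤ ε := by
    intro Y ε hY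
    refine (hf Y).trans ?_
    have := hconst (-ε)
    rw [neg_neg] at this
    rw [← this]
    refine hmono _ _ ?_
    filter_upwards [hY, Lp.coeFn_neg Y, Lp.coeFn_const (p := ∞) (μ := P) (-ε)] with ω h1 h2 h3
    rw [h2, h3]
    simpa using h1
  have hfneg : ∀ (Y : Lp ℝ ∞ P) (ε : ℝ), (∀ᵐ ω ∂P, -ε ≤ Y ω) → -ε ≤ f Y := by
    intro Y ε hY
    have := hfle (-Y) ε (by
      filter_upwards [hY, Lp.coeFn_neg Y] with ω h1 h2
      rw [h2, Pi.neg_apply]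
      linarith)
    rw [map_neg] at this
    linarith
  obtain ⟨m, hm⟩ := Charge.exists_expect_eq f fun Y ε _ hY => by
    refine abs_le.2 ⟨hfneg Y ε ?_, hfle Y ε ?_⟩
    · filter_upwards [hY] with ω hω using (abs_le.1 hω).1
    · filter_upwards [hY] with ω hω using (abs_le.1 hω).2
  refine ⟨m, ⟨?_, fun Y hY => ?_⟩, by rw [hm, hfZ]⟩
  · have h1 := m.expect_const 1
    rw [mul_one, hm] at h1
    rw [← h1]
    refine le_antisymm (hfle _ 1 ?_) ?_
    · filter_upwards [Lp.coeFn_const (p := ∞) (μ := P) (1 : ℝ)] with ω hω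
      rw [hω, Function.const_apply]
    · have := hfneg (Lp.const ∞ P (1 : ℝ)) (-1) (by
        filter_upwards [Lp.coeFn_const (p := ∞) (μ := P) (1 : ℝ)] with ω hω
        rw [hω, Function.const_apply, neg_neg])
      linarith
  · have := hf (-Y)
    rw [map_neg, neg_neg] at this
    rw [hm]
    linarith

lemma isLeast_expect_scalarPolar
    (h : IsCoherentVectorRisk P (Ici (0 : ℝ)) fun Z => fin (ρ Z)) (Z : Lp ℝ ∞ P) :
    IsLeast ((fun m : Charge P => m.expect Z) '' scalarPolar ρ) (-ρ Z) := by
  refine ⟨?_, ?_⟩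
  · obtain ⟨m, hm, hZ⟩ := exists_mem_scalarPolar_expect_eq h Z
    exact ⟨m, hm, hZ⟩
  · rintro _ ⟨m, hm, rfl⟩
    exact neg_le_expect_of_mem_scalarPolar h hm Z

lemma worstCase_scalarPolar
    (h : IsCoherentVectorRisk P (Ici (0 : ℝ)) fun Z => fin (ρ Z)) :
    worstCase (scalarPolar ρ) = ρ := by
  funext Z
  rw [worstCase, (isLeast_expect_scalarPolar h Z).csInf_eq, neg_neg]

end Scalar

section Vector

variable {Ω : Type*} [MeasurableSpace Ω] {P : Measure Ω} {d : ℕ}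
  {A : Matrix (Fin d) (Fin d) ℝ} {K : Set (Fin d → ℝ)}

/-! ### Random vectors and linear maps -/

lemma coeFn_coord (i : Fin d) (X : Lp (Fin d → ℝ) ∞ P) : ∀ᵐ ω ∂P, coord i X ω = X ω i :=
  ContinuousLinearMap.coeFn_compLp _ X

lemma coeFn_matMul (A : Matrix (Fin d) (Fin d) ℝ) (X : Lp (Fin d → ℝ) ∞ P) :
    ∀ᵐ ω ∂P, matMul A X ω = A.mulVec (X ω) :=
  ContinuousLinearMap.coeFn_compLp _ X

lemma matMul_add (A : Matrix (Fin d) (Fin d) ℝ) (X Y : Lp (Fin d → ℝ) ∞ P) :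
    matMul A (X + Y) = matMul A X + matMul A Y :=
  ((LinearMap.toContinuousLinearMap A.mulVecLin).compLpₗ ∞ P).map_add X Y

lemma matMul_smul (A : Matrix (Fin d) (Fin d) ℝ) (t : ℝ) (X : Lp (Fin d → ℝ) ∞ P) :
    matMul A (t • X) = t • matMul A X :=
  ((LinearMap.toContinuousLinearMap A.mulVecLin).compLpₗ ∞ P).map_smul t X

lemma coord_matMul (A : Matrix (Fin d) (Fin d) ℝ) (i : Fin d) (X : Lp (Fin d → ℝ) ∞ P) :
    coord i (matMul A X) = ∑ j, A i j • coord j X := by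
  have h0 : ∀ᵐ ω ∂P, ∀ j, (A i j • coord j X : Lp ℝ ∞ P) ω = A i j * X ω j := by
    refine ae_all_iff.2 fun j => ?_
    filter_upwards [Lp.coeFn_smul (A i j) (coord j X), coeFn_coord j X] with ω h1 h2
    rw [h1, Pi.smul_apply, h2, smul_eq_mul]
  apply Lp.ext
  filter_upwards [coeFn_coord i (matMul A X), coeFn_matMul A X, h0,
    Lp.coeFn_finsetSum Finset.univ fun j => A i j • coord j X] with ω h1 h2 h3 h4
  rw [h1, h2, h4, Finset.sum_apply, Finset.sum_congr rfl fun j _ => h3 j]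
  rfl

lemma coord_add (i : Fin d) (X Y : Lp (Fin d → ℝ) ∞ P) :
    coord i (X + Y) = coord i X + coord i Y :=
  ((ContinuousLinearMap.proj (R := ℝ) (φ := fun _ : Fin d => ℝ) i).compLpₗ ∞ P).map_add X Y

lemma vecExpect_row (A : Matrix (Fin d) (Fin d) ℝ) (i : Fin d) (m : Charge P)
    (X : Lp (Fin d → ℝ) ∞ P) :
    vecExpect (fun j => A i j • m) X = m.expect (coord i (matMul A X)) := by
  rw [coord_matMul, ← Charge.expectₗ_apply, map_sum]
  simp [vecExpect, Charge.smul_expect]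

lemma totalPairing_row (A : Matrix (Fin d) (Fin d) ℝ) (i : Fin d) (m : Charge P)
    (y : Fin d → ℝ) : totalPairing (fun j => A i j • m) y = m univ * A.mulVec y i := by
  simp only [totalPairing, Charge.smul_apply, Matrix.mulVec, dotProduct, Finset.mul_sum]
  exact Finset.sum_congr rfl fun j _ => by ring

/-- The random vector `Z A⁻¹ e_i`, for which `A (Z A⁻¹ e_i) = Z e_i`. -/
noncomputable def rowEmbed (A : Matrix (Fin d) (Fin d) ℝ) (i : Fin d) (Z : Lp ℝ ∞ P) :
    Lp (Fin d → ℝ) ∞ P :=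
  (ContinuousLinearMap.toSpanSingleton ℝ (A⁻¹.mulVec (Pi.single i 1))).compLp Z

lemma rowEmbed_add (A : Matrix (Fin d) (Fin d) ℝ) (i : Fin d) (Y Z : Lp ℝ ∞ P) :
    rowEmbed A i (Y + Z) = rowEmbed A i Y + rowEmbed A i Z :=
  ((ContinuousLinearMap.toSpanSingleton ℝ (A⁻¹.mulVec (Pi.single i 1))).compLpₗ ∞ P).map_add Y Z

lemma rowEmbed_smul (A : Matrix (Fin d) (Fin d) ℝ) (i : Fin d) (t : ℝ) (Z : Lp ℝ ∞ P) :
    rowEmbed A i (t • Z) = t • rowEmbed A i Z :=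
  ((ContinuousLinearMap.toSpanSingleton ℝ (A⁻¹.mulVec (Pi.single i 1))).compLpₗ ∞ P).map_smul t Z

lemma mulVec_mulVec_inv (hA : IsUnit A.det) (y : Fin d → ℝ) :
    A.mulVec (A⁻¹.mulVec y) = y := by
  rw [Matrix.mulVec_mulVec, Matrix.mul_nonsing_inv A hA, Matrix.one_mulVec]

lemma inv_mulVec_mulVec (hA : IsUnit A.det) (y : Fin d → ℝ) :
    A⁻¹.mulVec (A.mulVec y) = y := by
  rw [Matrix.mulVec_mulVec, Matrix.nonsing_inv_mul A hA, Matrix.one_mulVec]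

lemma mulVec_rowEmbed (hA : IsUnit A.det) (i : Fin d) (Z : Lp ℝ ∞ P) :
    ∀ᵐ ω ∂P, A.mulVec (rowEmbed A i Z ω) = Pi.single i (Z ω) := by
  filter_upwards [ContinuousLinearMap.coeFn_compLp
    (ContinuousLinearMap.toSpanSingleton ℝ (A⁻¹.mulVec (Pi.single i 1))) Z] with ω hω
  rw [rowEmbed, hω, ContinuousLinearMap.toSpanSingleton_apply, Matrix.mulVec_smul,
    mulVec_mulVec_inv hA, ← Pi.single_smul', smul_eq_mul, mul_one]

lemma coord_matMul_rowEmbed (hA : IsUnit A.det) (i : Fin d) (Z : Lp ℝ ∞ P) :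
    coord i (matMul A (rowEmbed A i Z)) = Z := by
  apply Lp.ext
  filter_upwards [coeFn_coord i (matMul A (rowEmbed A i Z)), coeFn_matMul A (rowEmbed A i Z),
    mulVec_rowEmbed hA i Z] with ω h1 h2 h3
  rw [h1, h2, h3, Pi.single_eq_same]

lemma rowPolar_one (𝒜 : Set (Lp (Fin d → ℝ) ∞ P)) (i : Fin d) :
    rowPolar 1 𝒜 i = marginalPolar 𝒜 i := by
  ext m
  have : (fun j => (1 : Matrix (Fin d) (Fin d) ℝ) i j • m) = Pi.single i m := by
    funext j
    refine Charge.ext_apply fun B => ?_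
    rw [Charge.smul_apply]
    rcases eq_or_ne j i with rfl | hj
    · simp
    · simp [hj, hj.symm, Charge.zero_apply]
  rw [rowPolar, marginalPolar, mem_ofPred_eq, mem_ofPred_eq, this]

lemma matMul_one (X : Lp (Fin d → ℝ) ∞ P) : matMul 1 X = X := by
  apply Lp.ext
  filter_upwards [coeFn_matMul 1 X] with ω hω
  rw [hω, Matrix.one_mulVec]

lemma mem_acceptanceSet_iff (hK : ∀ u, u ∈ K ↔ ∀ i, 0 ≤ A.mulVec u i)
    {r : Lp (Fin d → ℝ) ∞ P → Fin d → ℝ} (X : Lp (Fin d → ℝ) ∞ P) :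
    X ∈ acceptanceSet P (fun X => (fin (r X) : RiskSpace K)) ↔
      ∀ i, A.mulVec (r X) i ≤ 0 := by
  change 0 - r X ∈ K ↔ _
  rw [hK]
  simp [Matrix.mulVec_neg]

variable [IsProbabilityMeasure P] {r : Lp (Fin d → ℝ) ∞ P → Fin d → ℝ}

lemma matMul_const (A : Matrix (Fin d) (Fin d) ℝ) (y : Fin d → ℝ) :
    matMul A (Lp.const ∞ P y) = Lp.const ∞ P (A.mulVec y) := by
  apply Lp.ext
  filter_upwards [coeFn_matMul A (Lp.const ∞ P y), Lp.coeFn_const (p := ∞) (μ := P) y,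
    Lp.coeFn_const (p := ∞) (μ := P) (A.mulVec y)] with ω h1 h2 h3
  rw [h1, h2, h3]
  rfl

lemma coord_const (i : Fin d) (y : Fin d → ℝ) :
    coord i (Lp.const ∞ P y) = Lp.const ∞ P (y i) := by
  apply Lp.ext
  filter_upwards [coeFn_coord i (Lp.const ∞ P y), Lp.coeFn_const (p := ∞) (μ := P) y,
    Lp.coeFn_const (p := ∞) (μ := P) (y i)] with ω h1 h2 h3
  rw [h1, h2, h3]
  rfl

lemma vecExpect_add_const (μ : Fin d → Charge P) (X : Lp (Fin d → ℝ) ∞ P) (y : Fin d → ℝ) :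
    vecExpect μ (X + Lp.const ∞ P y) = vecExpect μ X + totalPairing μ y := by
  simp only [vecExpect, totalPairing, coord_add, coord_const, Charge.expect_add,
    Charge.expect_const, Finset.sum_add_distrib]

/-! ### The coordinates of a vector coherent risk measure -/

/-- A coherent risk measure for the cone `{u : A u ≥ 0}` is finite, as the cone has interior
points. -/
lemma exists_eq_fin_of_isCoherentVectorRisk (hA : IsUnit A.det)
    (hK : ∀ u, u ∈ K ↔ ∀ i, 0 ≤ A.mulVec u i) {ϱ : Lp (Fin d → ℝ) ∞ P → RiskSpace K}
    (h : IsCoherentVectorRisk P K ϱ) : ∃ r : Lp (Fin d → ℝ) ∞ P → Fin d → ℝ,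
      ϱ = fun X => fin (r X) := by
  suffices ∀ X, ∃ z, ϱ X = fin z by
    choose r hr using this
    exact ⟨r, funext hr⟩
  intro X
  obtain ⟨c, hc⟩ := exists_ae_norm_le (matMul A X)
  have hbound : ∀ᵐ ω ∂P, ∀ i, |A.mulVec (X ω) i| ≤ c := by
    filter_upwards [hc, coeFn_matMul A X] with ω h1 h2 i
    rw [← h2]
    exact (norm_le_pi_norm (matMul A X ω) i).trans h1
  have hdet : ∀ x, ϱ (Lp.const ∞ P x) = fin (-x) := fun x =>
    h.deterministic _ x (Lp.coeFn_const ..)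
  refine exists_eq_fin (x := - -A⁻¹.mulVec fun _ => c) (y := -A⁻¹.mulVec fun _ => c) ?_ ?_
  · rw [← hdet]
    refine h.monotone _ _ ?_
    filter_upwards [hbound, Lp.coeFn_const (p := ∞) (μ := P) (-A⁻¹.mulVec fun _ => c)]
      with ω h1 h2
    rw [h2, Function.const_apply, hK]
    intro i
    rw [Matrix.mulVec_sub, Matrix.mulVec_neg, mulVec_mulVec_inv hA]
    have := (abs_le.1 (h1 i)).1
    simp only [Pi.sub_apply, Pi.neg_apply]
    linarith
  · rw [← hdet]
    refine h.monotone _ _ ?_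
    filter_upwards [hbound, Lp.coeFn_const (p := ∞) (μ := P) (A⁻¹.mulVec fun _ => c)]
      with ω h1 h2
    rw [h2, Function.const_apply, hK]
    intro i
    rw [Matrix.mulVec_sub, mulVec_mulVec_inv hA]
    have := (abs_le.1 (h1 i)).2
    simp only [Pi.sub_apply]
    linarith

/-- The `i`-th coordinate of `A ϱ(X)` is monotone in `(A X)_i` alone: a deterministic vector `x`
with `(A x)_i = 0` can be added to make the other coordinates of `A X` as large as needed, and it
leaves the `i`-th coordinate of `A ϱ(X)` unchanged. -/
lemma mulVec_apply_le_of_ae_le (hA : IsUnit A.det)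
    (hK : ∀ u, u ∈ K ↔ ∀ i, 0 ≤ A.mulVec u i)
    (h : IsCoherentVectorRisk P K fun X => fin (r X)) (i : Fin d) {X Y : Lp (Fin d → ℝ) ∞ P}
    (hXY : ∀ᵐ ω ∂P, A.mulVec (Y ω) i ≤ A.mulVec (X ω) i) :
    A.mulVec (r X) i ≤ A.mulVec (r Y) i := by
  obtain ⟨c, hc⟩ := exists_ae_norm_le (matMul A X)
  obtain ⟨c', hc'⟩ := exists_ae_norm_le (matMul A Y)
  -- `A Y ≤ A X + y` in all coordinates, and `y` vanishes in place `i`.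
  let y : Fin d → ℝ := Function.update (fun _ => c + c') i 0
  have h1 : -A⁻¹.mulVec y + r X = r (X + Lp.const ∞ P (A⁻¹.mulVec y)) :=
    fin.inj (h.translation (A⁻¹.mulVec y) X)
  have h2 : r Y - r (X + Lp.const ∞ P (A⁻¹.mulVec y)) ∈ K := by
    refine h.monotone (X + Lp.const ∞ P (A⁻¹.mulVec y)) Y ?_
    filter_upwards [hc, hc', coeFn_matMul A X, coeFn_matMul A Y, hXY,
      Lp.coeFn_add X (Lp.const ∞ P (A⁻¹.mulVec y)),
      Lp.coeFn_const (p := ∞) (μ := P) (A⁻¹.mulVec y)] with ω h1 h2 h3 h4 h5 h6 h7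
    rw [h6, Pi.add_apply, h7, Function.const_apply, hK]
    intro j
    rw [Matrix.mulVec_sub, Matrix.mulVec_add, mulVec_mulVec_inv hA, Pi.sub_apply, Pi.add_apply]
    rcases eq_or_ne j i with rfl | hj
    · simp only [y, Function.update_self]
      linarith
    · have h8 := abs_le.1 ((norm_le_pi_norm (matMul A X ω) j).trans h1)
      have h9 := abs_le.1 ((norm_le_pi_norm (matMul A Y ω) j).trans h2)
      rw [h3] at h8
      rw [h4] at h9
      simp only [y, Function.update_of_ne hj]
      linarith [h8.1, h9.2]
  have h3 := (hK _).1 h2 i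
  rw [← h1, Matrix.mulVec_sub, Matrix.mulVec_add, Matrix.mulVec_neg, mulVec_mulVec_inv hA] at h3
  simp only [Pi.sub_apply, Pi.add_apply, Pi.neg_apply, y, Function.update_self] at h3
  linarith

/-- The `i`-th coordinate risk measure `Z ↦ (A ϱ(Z A⁻¹ e_i))_i`. -/
noncomputable def rowRisk (A : Matrix (Fin d) (Fin d) ℝ) (r : Lp (Fin d → ℝ) ∞ P → Fin d → ℝ)
    (i : Fin d) (Z : Lp ℝ ∞ P) : ℝ :=
  A.mulVec (r (rowEmbed A i Z)) i

lemma mulVec_apply_eq_rowRisk (hA : IsUnit A.det)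
    (hK : ∀ u, u ∈ K ↔ ∀ i, 0 ≤ A.mulVec u i)
    (h : IsCoherentVectorRisk P K fun X => fin (r X)) (i : Fin d) (X : Lp (Fin d → ℝ) ∞ P) :
    A.mulVec (r X) i = rowRisk A r i (coord i (matMul A X)) := by
  have hae : ∀ᵐ ω ∂P, A.mulVec (rowEmbed A i (coord i (matMul A X)) ω) i =
      A.mulVec (X ω) i := by
    filter_upwards [mulVec_rowEmbed hA i (coord i (matMul A X)), coeFn_coord i (matMul A X),
      coeFn_matMul A X] with ω h1 h2 h3
    rw [h1, Pi.single_eq_same, h2, h3]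
  refine le_antisymm (mulVec_apply_le_of_ae_le hA hK h i ?_)
    (mulVec_apply_le_of_ae_le hA hK h i ?_)
  · filter_upwards [hae] with ω hω using hω.le
  · filter_upwards [hae] with ω hω using hω.ge

lemma apply_const (h : IsCoherentVectorRisk P K fun X => fin (r X)) (y : Fin d → ℝ) :
    r (Lp.const ∞ P y) = -y :=
  fin.inj (h.deterministic _ y (Lp.coeFn_const ..))

lemma apply_zero (h : IsCoherentVectorRisk P K fun X => fin (r X)) : r 0 = 0 := by
  simpa using apply_const h 0

lemma isCoherentVectorRisk_rowRisk (hA : IsUnit A.det)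
    (hK : ∀ u, u ∈ K ↔ ∀ i, 0 ≤ A.mulVec u i)
    (h : IsCoherentVectorRisk P K fun X => fin (r X)) (i : Fin d) :
    IsCoherentVectorRisk P (Ici (0 : ℝ)) fun Z => fin (rowRisk A r i Z) where
  deterministic X x hX := by
    have hX : X = coord i (matMul A (Lp.const ∞ P (A⁻¹.mulVec fun _ => x))) := by
      rw [matMul_const, mulVec_mulVec_inv hA, coord_const]
      apply Lp.ext
      filter_upwards [hX, Lp.coeFn_const (p := ∞) (μ := P) x] with ω h1 h2
      rw [h1, h2, Function.const_apply]
    rw [hX, ← mulVec_apply_eq_rowRisk hA hK h, apply_const h, Matrix.mulVec_neg,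
      mulVec_mulVec_inv hA]
    rfl
  translation y Z := by
    let x := A⁻¹.mulVec fun _ => y
    have hr : -x + r (rowEmbed A i Z) = r (rowEmbed A i Z + Lp.const ∞ P x) :=
      fin.inj (h.translation x (rowEmbed A i Z))
    have hZ : Z + Lp.const ∞ P y = coord i (matMul A (rowEmbed A i Z + Lp.const ∞ P x)) := by
      rw [matMul_add, coord_add, coord_matMul_rowEmbed hA, matMul_const, mulVec_mulVec_inv hA,
        coord_const]
    rw [hZ, ← mulVec_apply_eq_rowRisk hA hK h, ← hr, Matrix.mulVec_add, Matrix.mulVec_neg,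
      mulVec_mulVec_inv hA]
    rfl
  monotone X Y hXY := by
    refine sub_nonneg.2 (mulVec_apply_le_of_ae_le hA hK h i ?_)
    filter_upwards [hXY, mulVec_rowEmbed hA i X, mulVec_rowEmbed hA i Y] with ω h1 h2 h3
    rw [h2, h3, Pi.single_eq_same, Pi.single_eq_same]
    exact sub_nonneg.1 h1
  homogeneous t Z ht := by
    have hr : r (t • rowEmbed A i Z) = t • r (rowEmbed A i Z) :=
      fin.inj (h.homogeneous t (rowEmbed A i Z) ht)
    rw [rowRisk, rowEmbed_smul, hr, Matrix.mulVec_smul]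
    rfl
  superadditive Y Z := by
    have hr : r (rowEmbed A i Y) + r (rowEmbed A i Z) - r (rowEmbed A i Y + rowEmbed A i Z) ∈ K :=
      h.superadditive (rowEmbed A i Y) (rowEmbed A i Z)
    have := (hK _).1 hr i
    rw [Matrix.mulVec_sub, Matrix.mulVec_add] at this
    change (0 : ℝ) ≤ rowRisk A r i Y + rowRisk A r i Z - rowRisk A r i (Y + Z)
    rwa [rowRisk, rowRisk, rowRisk, rowEmbed_add]

lemma rowPolar_acceptanceSet (hA : IsUnit A.det)
    (hK : ∀ u, u ∈ K ↔ ∀ i, 0 ≤ A.mulVec u i)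
    (h : IsCoherentVectorRisk P K fun X => fin (r X)) (i : Fin d) :
    rowPolar A (acceptanceSet P fun X => (fin (r X) : RiskSpace K)) i =
      scalarPolar (rowRisk A r i) := by
  ext m
  refine and_congr_right fun _ => ⟨fun hm Z hZ => ?_, fun hm X hX => ?_⟩
  · rw [← coord_matMul_rowEmbed hA i Z, ← vecExpect_row]
    refine hm _ ((mem_acceptanceSet_iff hK _).2 fun j => ?_)
    rcases eq_or_ne j i with rfl | hj
    · exact hZ
    · have h0 : A.mulVec (r 0) j = 0 := by simp [apply_zero h]
      rw [← h0]
      refine mulVec_apply_le_of_ae_le hA hK h j ?_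
      filter_upwards [mulVec_rowEmbed hA i Z, Lp.coeFn_zero (Fin d → ℝ) ∞ P] with ω h1 h2
      rw [h1, h2, Pi.single_eq_of_ne hj]
      simp
  · rw [vecExpect_row]
    refine hm _ ?_
    rw [← mulVec_apply_eq_rowRisk hA hK h]
    exact (mem_acceptanceSet_iff hK X).1 hX i

/-! ### Dual representation of vector coherent risk measures -/

variable {ϱ : Lp (Fin d → ℝ) ∞ P → RiskSpace K}

lemma rowPolar_acceptanceSet_properties (hA : IsUnit A.det)
    (hK : ∀ u, u ∈ K ↔ ∀ i, 0 ≤ A.mulVec u i) (h : IsCoherentVectorRisk P K ϱ) (i : Fin d) :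
    (rowPolar A (acceptanceSet P ϱ) i).Nonempty ∧
      (∀ Z : Lp ℝ ∞ P,
        BddBelow ((fun m => m.expect Z) '' rowPolar A (acceptanceSet P ϱ) i)) ∧
      IsCoherentVectorRisk P (Ici (0 : ℝ))
        (fun Z => fin (worstCase (rowPolar A (acceptanceSet P ϱ) i) Z)) := by
  obtain ⟨r, rfl⟩ := exists_eq_fin_of_isCoherentVectorRisk hA hK h
  have hs := isCoherentVectorRisk_rowRisk hA hK h i
  rw [rowPolar_acceptanceSet hA hK h, worstCase_scalarPolar hs]
  exact ⟨(isLeast_expect_scalarPolar hs 0).nonempty.of_image,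
    fun Z => (isLeast_expect_scalarPolar hs Z).bddBelow, hs⟩

lemma map_mulVec_eq_worstCase (hA : IsUnit A.det)
    (hK : ∀ u, u ∈ K ↔ ∀ i, 0 ≤ A.mulVec u i) (h : IsCoherentVectorRisk P K ϱ)
    {L : Set (Fin d → ℝ)} (X : Lp (Fin d → ℝ) ∞ P) :
    (ϱ X).map (L := L) A.mulVec = fin
      (fun i => worstCase (rowPolar A (acceptanceSet P ϱ) i) (coord i (matMul A X))) := by
  obtain ⟨r, rfl⟩ := exists_eq_fin_of_isCoherentVectorRisk hA hK h
  refine congrArg fin (funext fun i => ?_)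
  rw [rowPolar_acceptanceSet hA hK h,
    worstCase_scalarPolar (isCoherentVectorRisk_rowRisk hA hK h i),
    mulVec_apply_eq_rowRisk hA hK h]

/-- The reason is that the random vector `1_B u` is acceptable for `u ∈ K`. -/
lemma sum_apply_mul_nonneg_of_mem_polar (hA : IsUnit A.det)
    (hK : ∀ u, u ∈ K ↔ ∀ i, 0 ≤ A.mulVec u i) (h : IsCoherentVectorRisk P K ϱ)
    {μ : Fin d → Charge P} (hμ : μ ∈ polar (acceptanceSet P ϱ)) {u : Fin d → ℝ} (hu : u ∈ K)
    {B : Set Ω} (hB : MeasurableSet B) : 0 ≤ ∑ i, μ i B * u i := by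
  obtain ⟨r, rfl⟩ := exists_eq_fin_of_isCoherentVectorRisk hA hK h
  let X : Lp (Fin d → ℝ) ∞ P := indicatorConstLp ∞ hB (measure_ne_top P B) u
  have hX : ∀ᵐ ω ∂P, X ω = B.indicator (fun _ => u) ω := indicatorConstLp_coeFn
  have hcoord : ∀ i, coord i X = u i • indicatorConstLp ∞ hB (measure_ne_top P B) (1 : ℝ) := by
    intro i
    apply Lp.ext
    filter_upwards [coeFn_coord i X, hX,
      Lp.coeFn_smul (u i) (indicatorConstLp ∞ hB (measure_ne_top P B) (1 : ℝ)),
      indicatorConstLp_coeFn (p := ∞) (hs := hB) (hμs := measure_ne_top P B) (c := (1 : ℝ))]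
      with ω h1 h2 h3 h4
    rw [h1, h2, h3, Pi.smul_apply, h4]
    by_cases hω : ω ∈ B <;> simp [hω]
  have hval : vecExpect μ X = ∑ i, μ i B * u i := by
    refine Finset.sum_congr rfl fun i _ => ?_
    rw [hcoord, Charge.expect_smul, Charge.expect_indicatorConstLp, mul_comm]
  rw [← hval]
  refine hμ X ((mem_acceptanceSet_iff hK X).2 fun i => ?_)
  have h0 : A.mulVec (r 0) i = 0 := by simp [apply_zero h]
  rw [← h0]
  refine mulVec_apply_le_of_ae_le hA hK h i ?_
  filter_upwards [hX, Lp.coeFn_zero (Fin d → ℝ) ∞ P] with ω h1 h2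
  rw [h1, h2]
  by_cases hω : ω ∈ B
  · simpa [hω] using (hK u).1 hu i
  · simp [hω]

/-- The value `ϱ(X)` lies in all the dual half-spaces, since `X + ϱ(X)` is acceptable; it is their
least element in the order of `K` because of the half-spaces of the charges
`(a_{i1} m, …, a_{id} m)`. -/
lemma isLUB_dualHalfspace (hA : IsUnit A.det)
    (hK : ∀ u, u ∈ K ↔ ∀ i, 0 ≤ A.mulVec u i) (h : IsCoherentVectorRisk P K ϱ)
    (X : Lp (Fin d → ℝ) ∞ P) :
    IsLUB (fin '' ⋂ μ ∈ polar (acceptanceSet P ϱ), dualHalfspace μ X) (ϱ X) := by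
  obtain ⟨r, rfl⟩ := exists_eq_fin_of_isCoherentVectorRisk hA hK h
  have hmem : r X ∈ ⋂ μ ∈ polar (acceptanceSet P fun X => (fin (r X) : RiskSpace K)),
      dualHalfspace μ X := by
    refine mem_iInter₂.2 fun μ hμ => ?_
    have h1 : -r X + r X = r (X + Lp.const ∞ P (r X)) := fin.inj (h.translation (r X) X)
    have h2 := hμ (X + Lp.const ∞ P (r X)) ((mem_acceptanceSet_iff hK _).2 fun i => by
      rw [← h1, neg_add_cancel, Matrix.mulVec_zero, Pi.zero_apply])
    rw [vecExpect_add_const] at h2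
    exact neg_le_iff_add_nonneg'.2 h2
  refine ⟨?_, fun b hb => hb ⟨_, hmem, rfl⟩⟩
  rintro _ ⟨y, hy, rfl⟩
  refine (hK _).2 fun i => ?_
  have hs := isCoherentVectorRisk_rowRisk hA hK h i
  obtain ⟨m, hm, hmX⟩ := exists_mem_scalarPolar_expect_eq hs (coord i (matMul A X))
  have hm' := hm
  rw [← rowPolar_acceptanceSet hA hK h] at hm'
  have hle : -vecExpect (fun j => A i j • m) X ≤ totalPairing (fun j => A i j • m) y :=
    mem_iInter₂.1 hy _ hm'.2
  rw [vecExpect_row, totalPairing_row, hm.1, hmX, neg_neg, one_mul,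
    ← mulVec_apply_eq_rowRisk hA hK h] at hle
  rw [Matrix.mulVec_sub, Pi.sub_apply]
  exact sub_nonneg.2 hle

/-! ### Change of coordinates -/

lemma RiskSpace.map_mulVec_one (a : RiskSpace K) :
    a.map (L := K) (1 : Matrix (Fin d) (Fin d) ℝ).mulVec = a := by
  cases a <;> simp [RiskSpace.map]

/-- Coherence is preserved under a linear change of coordinates. -/
lemma IsCoherentVectorRisk.comp_matMul (hA : IsUnit A.det) {L : Set (Fin d → ℝ)}
    (hKL : ∀ u, A.mulVec u ∈ K ↔ u ∈ L) (h : IsCoherentVectorRisk P K ϱ) :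
    IsCoherentVectorRisk P L fun X => (ϱ (matMul A X)).map A⁻¹.mulVec := by
  have hinv : ∀ u, A⁻¹.mulVec u ∈ L ↔ u ∈ K := fun u => by
    rw [← hKL, mulVec_mulVec_inv hA]
  have hle : ∀ a b : RiskSpace K, a ≤ b →
      a.map (L := L) A⁻¹.mulVec ≤ b.map (L := L) A⁻¹.mulVec := by
    rintro (_ | _ | x) (_ | _ | y) hab
    case fin.fin =>
      change A⁻¹.mulVec x - A⁻¹.mulVec y ∈ L
      rw [← Matrix.mulVec_sub, hinv]
      exact hab
    all_goals exact hab
  have hadd : ∀ a b : RiskSpace K, (a + b).map (L := L) A⁻¹.mulVec =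
      a.map (L := L) A⁻¹.mulVec + b.map (L := L) A⁻¹.mulVec := by
    rintro (_ | _ | x) (_ | _ | y)
    case fin.fin => exact congrArg fin (Matrix.mulVec_add ..)
    all_goals rfl
  have hsmul : ∀ (t : ℝ) (a : RiskSpace K), (t • a).map (L := L) A⁻¹.mulVec =
      t • a.map (L := L) A⁻¹.mulVec := by
    rintro t (_ | _ | x)
    case fin => exact congrArg fin (Matrix.mulVec_smul ..)
    all_goals rfl
  refine { deterministic := ?_, translation := ?_, monotone := ?_, homogeneous := ?_,
           superadditive := ?_ }
  · intro X x hX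
    rw [h.deterministic (matMul A X) (A.mulVec x) (by
      filter_upwards [hX, coeFn_matMul A X] with ω h1 h2
      rw [h2, h1])]
    exact congrArg fin (by rw [Matrix.mulVec_neg, inv_mulVec_mulVec hA])
  · intro y X
    rw [matMul_add, matMul_const, ← h.translation, hadd]
    congr 1
    exact congrArg fin (by rw [Matrix.mulVec_neg, inv_mulVec_mulVec hA])
  · intro X Y hXY
    refine hle _ _ (h.monotone _ _ ?_)
    filter_upwards [hXY, coeFn_matMul A X, coeFn_matMul A Y] with ω h1 h2 h3
    rwa [h2, h3, ← Matrix.mulVec_sub, hKL]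
  · intro t X ht
    rw [matMul_smul, h.homogeneous t _ ht, hsmul]
  · intro X Y
    rw [matMul_add, ← hadd]
    exact hle _ _ (h.superadditive _ _)

end Vector

end VectorRisk

theorem mainTheorem5 {Ω : Type*} [MeasurableSpace Ω] (P : Measure Ω) [IsProbabilityMeasure P]
    (d : ℕ) :
    -- the coordinatewise order
    (∀ ϱ : Lp (Fin d → ℝ) ∞ P → RiskSpace (orthant d), IsCoherentVectorRisk P (orthant d) ϱ →
      (∀ μ ∈ polar (acceptanceSet P ϱ), ∀ (i : Fin d) (B : Set Ω), MeasurableSet B →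
        0 ≤ μ i B) ∧
      (∀ X, IsLUB (RiskSpace.fin '' ⋂ μ ∈ polar (acceptanceSet P ϱ), dualHalfspace μ X) (ϱ X)) ∧
      (∀ i : Fin d, (marginalPolar (acceptanceSet P ϱ) i).Nonempty ∧
        (∀ Z : Lp ℝ ∞ P,
          BddBelow ((fun m => m.expect Z) '' marginalPolar (acceptanceSet P ϱ) i)) ∧
        IsCoherentVectorRisk P (Ici (0 : ℝ))
          (fun Z => RiskSpace.fin (worstCase (marginalPolar (acceptanceSet P ϱ) i) Z))) ∧
      (∀ X, ϱ X = RiskSpace.fin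
        (fun i => worstCase (marginalPolar (acceptanceSet P ϱ) i) (coord i X)))) ∧
    -- the order generated by `K = A⁻¹ ℝ^d_+`
    (∀ A : Matrix (Fin d) (Fin d) ℝ, IsUnit A.det →
      (∀ ϱ : Lp (Fin d → ℝ) ∞ P → RiskSpace (orthant d), IsCoherentVectorRisk P (orthant d) ϱ →
        IsCoherentVectorRisk P (matrixCone A)
          (fun X => (ϱ (matMul A X)).map (A⁻¹).mulVec)) ∧
      (∀ ϱ : Lp (Fin d → ℝ) ∞ P → RiskSpace (matrixCone A),
        IsCoherentVectorRisk P (matrixCone A) ϱ →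
        IsCoherentVectorRisk P (orthant d)
          (fun X => (ϱ (matMul A⁻¹ X)).map A.mulVec) ∧
        (∀ μ ∈ polar (acceptanceSet P ϱ), ∀ u ∈ matrixCone A, ∀ B : Set Ω, MeasurableSet B →
          0 ≤ ∑ i, μ i B * u i) ∧
        (∀ X, IsLUB (RiskSpace.fin '' ⋂ μ ∈ polar (acceptanceSet P ϱ), dualHalfspace μ X)
          (ϱ X)) ∧
        (∀ i : Fin d, (rowPolar A (acceptanceSet P ϱ) i).Nonempty ∧
          (∀ Z : Lp ℝ ∞ P,
            BddBelow ((fun m => m.expect Z) '' rowPolar A (acceptanceSet P ϱ) i)) ∧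
          IsCoherentVectorRisk P (Ici (0 : ℝ))
            (fun Z => RiskSpace.fin (worstCase (rowPolar A (acceptanceSet P ϱ) i) Z))) ∧
        (∀ X, (ϱ X).map (L := orthant d) A.mulVec = RiskSpace.fin
          (fun i => worstCase (rowPolar A (acceptanceSet P ϱ) i) (coord i (matMul A X)))))) := by
  refine ⟨fun ϱ h => ?_, fun A hA => ⟨fun ϱ h => ?_, fun ϱ h => ⟨?_, ?_, ?_, ?_, ?_⟩⟩⟩
  · have hA : IsUnit (1 : Matrix (Fin d) (Fin d) ℝ).det := by simp
    have hK : ∀ u, u ∈ orthant d ↔ ∀ i, 0 ≤ (1 : Matrix (Fin d) (Fin d) ℝ).mulVec u i := by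
      simp [orthant]
    refine ⟨fun μ hμ i B hB => ?_, isLUB_dualHalfspace hA hK h, fun i => ?_, fun X => ?_⟩
    · have hu : Pi.single i 1 ∈ orthant d := fun j => by
        rcases eq_or_ne j i with rfl | hj
        · simp
        · simp [hj]
      simpa [Pi.single_apply] using sum_apply_mul_nonneg_of_mem_polar hA hK h hμ hu hB
    · simpa only [rowPolar_one] using rowPolar_acceptanceSet_properties hA hK h i
    · simpa only [rowPolar_one, matMul_one, RiskSpace.map_mulVec_one] using
        map_mulVec_eq_worstCase (L := orthant d) hA hK h X
  · exact h.comp_matMul hA fun _ => Iff.rfl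
  · have h' := h.comp_matMul (A := A⁻¹) (L := orthant d)
      (A.isUnit_nonsing_inv_det hA) fun u => by
        simp only [matrixCone, orthant, mem_ofPred_eq, mulVec_mulVec_inv hA]
    rwa [Matrix.nonsing_inv_nonsing_inv A hA] at h'
  · exact fun μ hμ u hu B hB =>
      sum_apply_mul_nonneg_of_mem_polar hA (fun _ => Iff.rfl) h hμ hu hB
  · exact isLUB_dualHalfspace hA (fun _ => Iff.rfl) h
  · exact rowPolar_acceptanceSet_properties hA (fun _ => Iff.rfl) h
  · exact map_mulVec_eq_worstCase hA (fun _ => Iff.rfl) h
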